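/- For a finite group $G$ let $B(G)$ be its Burnside ring, i.e. the Grothendieck ring of finite $G$-sets under disjoint union and cartesian product, and for $U\le G$ let $x\mapsto |x^U|$, $B(G)\to\mathbb Z$, be the ring homomorphism induced by counting $U$-fixed points. If $C$ is a cyclic group of order $|G|$, the Frobenius–Wielandt morphism $\alpha^G:B(C)\to B(G)$ is the unique ring homomorphism such that $|\alpha^G(x)^U|=|x^{C_{|U|}}|$ for all $x\in B(C)$ and all $U\le G$, where $C_{|U|}$ is the subgroup of $C$ of order $|U|$. For $H\le G$, tensor induction $\mathrm{Ten}_H^G:B(H)\to B(G)$ is the multiplicative map that sends the class of a finite $H$-set $X$ to the class of the $G$-set $\{f:G\to X\mid f(gh)=h^{-1}f(g)\ \text{for all } g\in G,\ h\in H\}$, with action $(gf)(g_1)=f(g^{-1}g_1)$, and is extended to differences $[X]-[Y]$ polynomially: $\mathrm{Ten}_H^G([X]-[Y])$ is the value at $k=-1$ of the polynomial in $k$ that takes the value $\mathrm{Ten}_H^G([X]+k[Y])$ at every integer $k\ge 0$. **Proposition.** Let $G$ be a finite group, $C$ a cyclic group of order $|G|$, $H$ a subgroup of $G$, and $C_H$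 the subgroup of $C$ of order $|H|$. Then $$\alpha^G\circ \mathrm{Ten}_{C_H}^{C}=\mathrm{Ten}_H^G\circ\alpha^H \quad\text{as maps } B(C_H)\to B(G)$$ if and only if $G$ and $H$ satisfy the gcd property, that is, $|K\cap H|=\gcd(|K|,|H|)$ for every subgroup $K\le G$. In particular, if the equality of maps holds, then $H$ is a normal subgroup of $G$. -/

import Mathlib

universe u v

namespace FrobWiel

noncomputable section

/-! ### Finite `G`-sets -/

/-- A finite (left) `G`-set. -/
structure FinGSet (G : Type u) [Group G] : Type (u + 1) where
  carrier : Type u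
  [action : MulAction G carrier]
  [finite : Finite carrier]

attribute [instance] FinGSet.action FinGSet.finite

namespace FinGSet

variable {G : Type u} [Group G]

/-- Isomorphism of `G`-sets: existence of a `G`-equivariant bijection. -/
def Iso (X Y : FinGSet G) : Prop :=
  ∃ e : X.carrier ≃ Y.carrier, ∀ (g : G) (x : X.carrier), e (g • x) = g • e x

theorem Iso.refl (X : FinGSet G) : Iso X X := ⟨Equiv.refl _, fun _ _ => rfl⟩

theorem Iso.symm {X Y : FinGSet G} : Iso X Y → Iso Y X := by
  rintro ⟨e, he⟩
  refine ⟨e.symm, fun g y => ?_⟩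
  rw [Equiv.symm_apply_eq, he, Equiv.apply_symm_apply]

theorem Iso.trans {X Y Z : FinGSet G} : Iso X Y → Iso Y Z → Iso X Z := by
  rintro ⟨e, he⟩ ⟨f, hf⟩
  exact ⟨e.trans f, fun g x => by simp [he, hf]⟩

/-- Isomorphism as an equivalence relation on finite `G`-sets. -/
instance isoSetoid : Setoid (FinGSet G) :=
  ⟨Iso, Iso.refl, Iso.symm, Iso.trans⟩

/-- The disjoint union of two `G`-sets. -/
def sum (X Y : FinGSet G) : FinGSet G := ⟨X.carrier ⊕ Y.carrier⟩

/-- The cartesian product of two `G`-sets, with diagonal action. -/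
def prod (X Y : FinGSet G) : FinGSet G := ⟨X.carrier × Y.carrier⟩

/-- The one-point `G`-set. -/
def point : FinGSet G := ⟨PUnit⟩

/-- The set of points of `X` fixed by every element of `U`. -/
def fixed (U : Subgroup G) (X : FinGSet G) : Set X.carrier := {x | ∀ g ∈ U, g • x = x}

theorem card_fixed_of_iso (U : Subgroup G) {X Y : FinGSet G} (h : Iso X Y) :
    Nat.card (fixed U X) = Nat.card (fixed U Y) := by
  obtain ⟨e, he⟩ := h
  refine Nat.card_congr (e.subtypeEquiv fun x => ?_)
  simp only [fixed, Set.mem_ofPred_eq, ← he, e.apply_eq_iff_eq]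

theorem card_fixed_sum (U : Subgroup G) (X Y : FinGSet G) :
    Nat.card (fixed U (sum X Y)) = Nat.card (fixed U X) + Nat.card (fixed U Y) := by
  rw [← Nat.card_sum]
  refine Nat.card_congr ((Equiv.subtypeSum (p := fun z => z ∈ fixed U (sum X Y))).trans
    (Equiv.sumCongr (Equiv.subtypeEquivRight fun x => ?_) (Equiv.subtypeEquivRight fun x => ?_)))
  · exact forall₂_congr fun g _ => Sum.inl_injective.eq_iff (a := g • x)
  · exact forall₂_congr fun g _ => Sum.inr_injective.eq_iff (a := g • x)

theorem card_fixed_prod (U : Subgroup G) (X Y : FinGSet G) :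
    Nat.card (fixed U (prod X Y)) = Nat.card (fixed U X) * Nat.card (fixed U Y) := by
  rw [← Nat.card_prod]
  refine Nat.card_congr ((Equiv.subtypeEquivRight fun z => ?_).trans
    (Equiv.subtypeProdEquivProd (p := (· ∈ fixed U X)) (q := (· ∈ fixed U Y))))
  constructor
  · exact fun h => ⟨fun g hg => congrArg Prod.fst (h g hg), fun g hg => congrArg Prod.snd (h g hg)⟩
  · exact fun h g hg => Prod.ext (h.1 g hg) (h.2 g hg)

theorem card_fixed_point (U : Subgroup G) : Nat.card (fixed U (point : FinGSet G)) = 1 := by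
  have : fixed U (point : FinGSet G) = Set.univ := Set.eq_univ_of_forall fun x g _ => rfl
  rw [this, Nat.card_coe_set_eq, Set.ncard_univ]
  exact Nat.card_unique (α := PUnit)

end FinGSet

open FinGSet

/-! ### The Burnside ring -/

/-- Isomorphism classes of finite `G`-sets. -/
abbrev GSetClass (G : Type u) [Group G] : Type (u + 1) := Quotient (isoSetoid (G := G))

/-- Isomorphism classes form a commutative monoid under the cartesian product. -/
instance (G : Type u) [Group G] : CommMonoid (GSetClass G) where
  mul := Quotient.map₂ prod (by
    rintro X X' ⟨e, he⟩ Y Y' ⟨f, hf⟩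
    exact ⟨Equiv.prodCongr e f, fun g x => Prod.ext (he g x.1) (hf g x.2)⟩)
  one := Quotient.mk _ point
  mul_assoc := by
    rintro ⟨X⟩ ⟨Y⟩ ⟨Z⟩
    exact Quotient.sound ⟨Equiv.prodAssoc _ _ _, fun _ _ => rfl⟩
  one_mul := by
    rintro ⟨X⟩
    exact Quotient.sound ⟨Equiv.punitProd _, fun _ _ => rfl⟩
  mul_one := by
    rintro ⟨X⟩
    exact Quotient.sound ⟨Equiv.prodPUnit _, fun _ _ => rfl⟩
  mul_comm := by
    rintro ⟨X⟩ ⟨Y⟩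
    exact Quotient.sound ⟨Equiv.prodComm _ _, fun _ _ => rfl⟩

/-- The ideal of relations `[X ⊔ Y] = [X] + [Y]`. -/
def burnsideRel (G : Type u) [Group G] : Ideal (FreeAbelianGroup (GSetClass G)) :=
  Ideal.span {a | ∃ X Y : FinGSet G, a = FreeAbelianGroup.of (Quotient.mk _ (sum X Y))
    - FreeAbelianGroup.of (Quotient.mk _ X) - FreeAbelianGroup.of (Quotient.mk _ Y)}

/-- The Burnside ring `B(G)`: the Grothendieck ring of finite `G`-sets under disjoint union and
cartesian product. -/
abbrev BurnsideRing (G : Type u) [Group G] : Type (u + 1) :=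
  FreeAbelianGroup (GSetClass G) ⧸ burnsideRel G

section

variable {G : Type u} [Group G]

/-- The class `[X]` in `B(G)` of a finite `G`-set `X`. -/
def ofSet (X : FinGSet G) : BurnsideRing G :=
  Ideal.Quotient.mk (burnsideRel G) (FreeAbelianGroup.of (Quotient.mk _ X))

theorem ofSet_eq_of_iso {X Y : FinGSet G} (h : Iso X Y) : ofSet X = ofSet Y := by
  unfold ofSet
  rw [Quotient.sound (s := isoSetoid) h]

theorem ofSet_sum (X Y : FinGSet G) : ofSet (sum X Y) = ofSet X + ofSet Y := by
  have h : FreeAbelianGroup.of (Quotient.mk isoSetoid (sum X Y))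
    - FreeAbelianGroup.of (Quotient.mk isoSetoid X)
    - FreeAbelianGroup.of (Quotient.mk isoSetoid Y) ∈ burnsideRel G :=
    Ideal.subset_span ⟨X, Y, rfl⟩
  have h' := Ideal.Quotient.eq_zero_iff_mem.2 h
  rw [map_sub, map_sub, sub_sub, sub_eq_zero] at h'
  exact h'

theorem ofSet_prod (X Y : FinGSet G) : ofSet (prod X Y) = ofSet X * ofSet Y := by
  unfold ofSet
  rw [← map_mul, FreeAbelianGroup.of_mul_of]
  rfl

theorem ofSet_point : ofSet (point : FinGSet G) = 1 := rfl

theorem ofSet_of_isEmpty (X : FinGSet G) [IsEmpty X.carrier] : ofSet X = 0 := by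
  have h := ofSet_sum X X
  rw [ofSet_eq_of_iso (X := sum X X) (Y := X)
    ⟨Equiv.sumEmpty _ _, fun g x => by rcases x with x | x <;> exact isEmptyElim x⟩] at h
  simpa using h

/-- Every element of `B(G)` is a difference of classes of finite `G`-sets. -/
theorem exists_eq_sub (a : BurnsideRing G) :
    ∃ p : FinGSet G × FinGSet G, a = ofSet p.1 - ofSet p.2 := by
  obtain ⟨b, rfl⟩ := Ideal.Quotient.mk_surjective a
  induction b using FreeAbelianGroup.induction_on with
  | zero => exact ⟨(point, point), by simp⟩
  | of x =>
    induction x using Quotient.inductionOn with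
    | h X => exact ⟨(sum X point, point), by rw [ofSet_sum, add_sub_cancel_right]; rfl⟩
  | neg x hx =>
    obtain ⟨p, hp⟩ := hx
    exact ⟨(p.2, p.1), by rw [map_neg, hp, neg_sub]⟩
  | add x y hx hy =>
    obtain ⟨p, hp⟩ := hx
    obtain ⟨q, hq⟩ := hy
    exact ⟨(sum p.1 q.1, sum p.2 q.2), by rw [map_add, hp, hq, ofSet_sum, ofSet_sum]; abel⟩

/-- The ring homomorphism of fixed points `B(G) → ℤ`, `x ↦ |x^U|`. -/
def mark (U : Subgroup G) : BurnsideRing G →+* ℤ :=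
  Ideal.Quotient.lift (burnsideRel G)
    (FreeAbelianGroup.liftMonoid
      ({ toFun := fun x => Quotient.liftOn x (fun X => (Nat.card (fixed U X) : ℤ))
          fun _ _ h => by rw [card_fixed_of_iso U h]
         map_one' := by
          change ((Nat.card (fixed U (point : FinGSet G)) : ℕ) : ℤ) = 1
          rw [card_fixed_point]; rfl
         map_mul' := by
          rintro ⟨X⟩ ⟨Y⟩
          change ((Nat.card (fixed U (prod X Y)) : ℕ) : ℤ) = _
          rw [card_fixed_prod]
          push_cast
          rfl } : GSetClass G →* ℤ)) (by
    intro a ha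
    rw [← RingHom.mem_ker]
    revert a
    change burnsideRel G ≤ _
    refine Ideal.span_le.2 ?_
    rintro _ ⟨X, Y, rfl⟩
    rw [SetLike.mem_coe, RingHom.mem_ker, map_sub, map_sub]
    simp only [FreeAbelianGroup.liftMonoid_coe, FreeAbelianGroup.lift_apply_of]
    change ((Nat.card (fixed U (sum X Y)) : ℕ) : ℤ) - (Nat.card (fixed U X) : ℕ)
      - (Nat.card (fixed U Y) : ℕ) = 0
    rw [card_fixed_sum]
    push_cast
    ring)

theorem mark_ofSet (U : Subgroup G) (X : FinGSet G) :
    mark U (ofSet X) = Nat.card (fixed U X) := by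
  unfold mark ofSet
  rw [Ideal.Quotient.lift_mk]
  simp only [FreeAbelianGroup.liftMonoid_coe, FreeAbelianGroup.lift_apply_of]
  rfl

/-! ### Elements of the Burnside ring are determined by their marks -/

/-- A subset of a `G`-set that is stable under `G`, as a `G`-set. -/
def FinGSet.sub (X : FinGSet G) (s : Set X.carrier) (hs : ∀ (g : G), ∀ x ∈ s, g • x ∈ s) :
    FinGSet G :=
  letI : MulAction G s :=
    { smul := fun g x => ⟨g • x.1, hs g x.1 x.2⟩
      one_smul := fun x => Subtype.ext (one_smul G x.1)
      mul_smul := fun g h x => Subtype.ext (mul_smul g h x.1) }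
  ⟨s⟩

/-- The transitive `G`-set `G / U`. -/
def FinGSet.cosets [Finite G] (U : Subgroup G) : FinGSet G := ⟨G ⧸ U⟩

/-- Removing the orbit of a point. -/
theorem exists_split [Finite G] (X : FinGSet G) (x : X.carrier) :
    ∃ Y : FinGSet G, Iso X (sum (cosets (MulAction.stabilizer G x)) Y) ∧
      ∃ f : Y.carrier → X.carrier, Function.Injective f ∧ (∀ (g : G) y, f (g • y) = g • f y) ∧
        ∀ y, f y ∉ MulAction.orbit G x := by
  classical
  have hs : ∀ (g : G), ∀ y ∈ (MulAction.orbit G x)ᶜ, g • y ∈ (MulAction.orbit G x)ᶜ := by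
    intro g y hy h
    obtain ⟨k, hk⟩ := h
    exact hy ⟨g⁻¹ * k, by
      change (g⁻¹ * k) • x = y
      rw [mul_smul]
      exact inv_smul_eq_iff.2 hk⟩
  refine ⟨X.sub (MulAction.orbit G x)ᶜ hs, ?_, fun y => y.1, Subtype.val_injective,
    fun _ _ => rfl, fun y => y.2⟩
  refine Iso.symm ⟨(Equiv.sumCongr (MulAction.orbitEquivQuotientStabilizer G x).symm
    (Equiv.refl _)).trans (Equiv.Set.sumCompl (MulAction.orbit G x)), ?_⟩
  rintro g (q | y)
  · induction q using QuotientGroup.induction_on with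
    | H a =>
      change ((MulAction.orbitEquivQuotientStabilizer G x).symm ((g * a : G) : G ⧸ _) : X.carrier)
        = g • ((MulAction.orbitEquivQuotientStabilizer G x).symm (a : G ⧸ _) : X.carrier)
      rw [MulAction.orbitEquivQuotientStabilizer_symm_apply,
        MulAction.orbitEquivQuotientStabilizer_symm_apply, mul_smul]
  · rfl

theorem iso_of_card_fixed [Finite G] : ∀ (n : ℕ) (X Y : FinGSet G), Nat.card X.carrier = n →
    (∀ U : Subgroup G, Nat.card (fixed U X) = Nat.card (fixed U Y)) → Iso X Y := by
  intro n
  induction n using Nat.strong_induction_on with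
  | _ n ih =>
    intro X Y hn h
    have hne : ∀ (Z : FinGSet G) (U : Subgroup G), 0 < Nat.card (fixed U Z) ↔
        ∃ z : Z.carrier, U ≤ MulAction.stabilizer G z := by
      intro Z U
      rw [Nat.card_pos_iff]
      constructor
      · rintro ⟨⟨z, hz⟩, -⟩
        exact ⟨z, fun g hg => hz g hg⟩
      · rintro ⟨z, hz⟩
        exact ⟨⟨⟨z, fun g hg => hz hg⟩⟩, inferInstance⟩
    by_cases hX : IsEmpty X.carrier
    · have hY : IsEmpty Y.carrier := by
        by_contra hY
        rw [not_isEmpty_iff] at hY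
        obtain ⟨y⟩ := hY
        obtain ⟨x, -⟩ := (hne X ⊥).1 (by rw [h]; exact (hne Y ⊥).2 ⟨y, bot_le⟩)
        exact hX.false x
      exact ⟨Equiv.equivOfIsEmpty _ _, fun g x => isEmptyElim x⟩
    · rw [not_isEmpty_iff] at hX
      obtain ⟨x₀⟩ := hX
      obtain ⟨U, hU⟩ := Set.Finite.exists_maximal (s := {U : Subgroup G | 0 < Nat.card (fixed U X)})
        (Set.toFinite _) ⟨⊥, (hne X ⊥).2 ⟨x₀, bot_le⟩⟩
      have key : ∀ Z : FinGSet G, (∀ V : Subgroup G, Nat.card (fixed V X) = Nat.card (fixed V Z)) →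
          ∃ z : Z.carrier, MulAction.stabilizer G z = U := by
        intro Z hZ
        obtain ⟨z, hz⟩ := (hne Z U).1 (by rw [← hZ]; exact hU.prop)
        refine ⟨z, le_antisymm (hU.le_of_ge ?_ hz) hz⟩
        change 0 < _
        rw [hZ]
        exact (hne Z _).2 ⟨z, le_rfl⟩
      obtain ⟨x, hx⟩ := key X fun _ => rfl
      obtain ⟨y, hy⟩ := key Y h
      obtain ⟨X', hX', -⟩ := exists_split X x
      obtain ⟨Y', hY', -⟩ := exists_split Y y
      rw [hx] at hX'
      rw [hy] at hY'
      have hcard : Nat.card X'.carrier < n := by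
        obtain ⟨e, -⟩ := hX'
        have h1 := Nat.card_congr e
        have h2 : Nat.card (sum (cosets U) X').carrier =
          Nat.card (G ⧸ U) + Nat.card X'.carrier := Nat.card_sum
        have h3 : 0 < Nat.card (G ⧸ U) := Nat.card_pos
        omega
      obtain ⟨e, he⟩ := ih _ hcard X' Y' rfl (fun V => by
        have := h V
        rw [card_fixed_of_iso V hX', card_fixed_of_iso V hY', card_fixed_sum, card_fixed_sum] at this
        omega)
      refine hX'.trans (Iso.trans ⟨Equiv.sumCongr (Equiv.refl _) e, ?_⟩ hY'.symm)
      rintro g (q | z)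
      · rfl
      · exact congrArg Sum.inr (he g z)

theorem ext_mark [Finite G] {a b : BurnsideRing G} (h : ∀ U : Subgroup G, mark U a = mark U b) :
    a = b := by
  rw [← sub_eq_zero]
  obtain ⟨p, hp⟩ := exists_eq_sub (a - b)
  rw [hp, sub_eq_zero]
  refine ofSet_eq_of_iso (iso_of_card_fixed _ _ _ rfl fun U => ?_)
  have h1 := congrArg (mark U) hp
  rw [map_sub, map_sub, h U, sub_self, mark_ofSet, mark_ofSet, eq_comm, sub_eq_zero] at h1
  exact_mod_cast h1

end

/-! ### The Frobenius-Wielandt morphism -/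

section

/-- The `G`-set of `d`-element subsets of `G`, with `g` acting by `A ↦ A g⁻¹`. -/
def FinGSet.subsets (G : Type u) [Group G] [Finite G] (d : ℕ) : FinGSet G :=
  letI : MulAction G {A : Set G // Nat.card A = d} :=
    { smul := fun g A => ⟨(· * g) ⁻¹' A.1, by
        refine Eq.trans ?_ A.2
        exact Nat.card_congr ((Equiv.mulRight g).subtypeEquiv fun _ => Iff.rfl)⟩
      one_smul := fun A => Subtype.ext (by
        ext x
        change x * 1 ∈ A.1 ↔ x ∈ A.1
        rw [mul_one])
      mul_smul := fun g h A => Subtype.ext (by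
        ext x
        change x * (g * h) ∈ A.1 ↔ x * g * h ∈ A.1
        rw [mul_assoc]) }
  ⟨{A : Set G // Nat.card A = d}⟩

theorem card_preimage_mk {G : Type u} [Group G] (U : Subgroup G) (B : Set (G ⧸ U)) :
    Nat.card ((QuotientGroup.mk : G → G ⧸ U) ⁻¹' B) = Nat.card U * Nat.card B := by
  rw [← Nat.card_prod]
  exact Nat.card_congr (QuotientGroup.preimageMkEquivSubgroupProdSet U B)

theorem preimage_image_mk {G : Type u} [Group G] (U : Subgroup G) (A : Set G)
    (hA : ∀ g ∈ U, ∀ x ∈ A, x * g ∈ A) :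
    (QuotientGroup.mk : G → G ⧸ U) ⁻¹' (QuotientGroup.mk '' A) = A := by
  refine Set.Subset.antisymm ?_ (Set.subset_preimage_image _ _)
  rintro x ⟨a, ha, hax⟩
  have := hA _ (QuotientGroup.eq.1 hax) a ha
  rwa [mul_inv_cancel_left] at this

theorem card_fixed_subsets {G : Type u} [Group G] [Finite G] (U : Subgroup G) (d : ℕ) :
    Nat.card (fixed U (subsets G d)) =
      Nat.card {B : Set (G ⧸ U) // Nat.card U * Nat.card B = d} := by
  symm
  let F : {B : Set (G ⧸ U) // Nat.card U * Nat.card B = d} → fixed U (subsets G d) := fun B =>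
    ⟨⟨QuotientGroup.mk ⁻¹' B.1, (card_preimage_mk U B.1).trans B.2⟩, fun g hg => Subtype.ext (by
      ext x
      change ((x * g : G) : G ⧸ U) ∈ B.1 ↔ (x : G ⧸ U) ∈ B.1
      rw [QuotientGroup.mk_mul_of_mem x hg])⟩
  refine Nat.card_congr (Equiv.ofBijective F ⟨?_, ?_⟩)
  · intro B B' h
    exact Subtype.ext (Set.preimage_injective.2 QuotientGroup.mk_surjective
      (congrArg (fun z => z.1.1) h))
  · rintro ⟨A, hA⟩
    have h1 : (QuotientGroup.mk : G → G ⧸ U) ⁻¹' (QuotientGroup.mk '' A.1) = A.1 := by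
      refine preimage_image_mk U A.1 fun g hg x hx => ?_
      have : x ∈ (g • A).1 := by rw [hA g hg]; exact hx
      exact this
    refine ⟨⟨QuotientGroup.mk '' A.1, ?_⟩, Subtype.ext (Subtype.ext h1)⟩
    rw [← card_preimage_mk, h1]
    exact A.2

theorem card_fixed_subsets_eq {G : Type u} {C : Type v} [Group G] [Finite G] [Group C] [Finite C]
    (hC : Nat.card C = Nat.card G) (U : Subgroup G) (V : Subgroup C)
    (h : Nat.card V = Nat.card U) (d : ℕ) :
    Nat.card (fixed U (subsets G d)) = Nat.card (fixed V (subsets C d)) := by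
  have hq : Nat.card (G ⧸ U) = Nat.card (C ⧸ V) := by
    have h1 := Subgroup.card_eq_card_quotient_mul_card_subgroup U
    have h2 := Subgroup.card_eq_card_quotient_mul_card_subgroup V
    rw [hC, h1, h] at h2
    exact Nat.eq_of_mul_eq_mul_right Nat.card_pos h2
  let e : G ⧸ U ≃ C ⧸ V := (Finite.equivFin _).trans ((finCongr hq).trans (Finite.equivFin _).symm)
  rw [card_fixed_subsets, card_fixed_subsets]
  refine Nat.card_congr ((Equiv.Set.congr e).subtypeEquiv fun B => ?_)
  have h1 : Nat.card B = Nat.card (Equiv.Set.congr e B) := Nat.card_congr (e.image B)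
  rw [h, h1]

theorem eq_of_card_eq {C : Type v} [Group C] [Finite C] [IsCyclic C] {D E : Subgroup C}
    (h : Nat.card D = Nat.card E) : D = E := by
  classical
  have := Fintype.ofFinite C
  have hle := IsCyclic.card_pow_eq_one_le (α := C) (n := Nat.card D) Nat.card_pos
  have key : ∀ E : Subgroup C, Nat.card E = Nat.card D →
      (E : Set C).toFinset = Finset.univ.filter (fun c : C => c ^ Nat.card D = 1) := by
    intro E hE
    refine Finset.eq_of_subset_of_card_le ?_ ?_
    · intro c hc
      rw [Set.mem_toFinset] at hc
      rw [Finset.mem_filter]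
      refine ⟨Finset.mem_univ _, ?_⟩
      rw [← hE]
      have h1 := pow_card_eq_one' (G := E) (x := ⟨c, hc⟩)
      exact congrArg Subtype.val h1
    · refine hle.trans ?_
      rw [← hE, Set.toFinset_card, Nat.card_eq_fintype_card]
      rfl
  have := (key D rfl).trans (key E h.symm).symm
  rw [Set.toFinset_inj] at this
  exact SetLike.coe_injective this

theorem exists_card_eq {C : Type v} [Group C] [Finite C] [IsCyclic C] {d : ℕ}
    (h : d ∣ Nat.card C) : ∃ V : Subgroup C, Nat.card V = d := by
  obtain ⟨g, hg⟩ := IsCyclic.exists_ofOrder_eq_natCard (α := C)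
  obtain ⟨k, hk⟩ := h
  have hpos : 0 < Nat.card C := Nat.card_pos
  have hk0 : k ≠ 0 := by rintro rfl; simp at hk; omega
  refine ⟨Subgroup.zpowers (g ^ k), ?_⟩
  rw [Nat.card_zpowers, orderOf_pow_of_dvd hk0 (by rw [hg, hk]; exact dvd_mul_left _ _), hg, hk,
    Nat.mul_div_cancel _ (Nat.pos_of_ne_zero hk0)]

variable {G : Type u} {C : Type v} [Group G] [Group C]

/-- `α : B(C) → B(G)` is such that for all `x ∈ B(C)` and `U ≤ G` the number of `U`-fixed points of
`α x` equals the number of `V`-fixed points of `x`, for `V` the subgroup of `C` of order `|U|`. -/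
def IsFW (α : BurnsideRing C →+* BurnsideRing G) : Prop :=
  ∀ (U : Subgroup G) (V : Subgroup C), Nat.card V = Nat.card U →
    ∀ x : BurnsideRing C, mark U (α x) = mark V x

/-- The elements of `B(C)` that have an image under the Frobenius-Wielandt morphism. -/
def fwDomain (G : Type u) (C : Type v) [Group G] [Group C] : AddSubgroup (BurnsideRing C) where
  carrier := {x | ∃ y : BurnsideRing G, ∀ (U : Subgroup G) (V : Subgroup C),
    Nat.card V = Nat.card U → mark U y = mark V x}
  zero_mem' := ⟨0, fun U V _ => by rw [map_zero, map_zero]⟩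
  add_mem' := by
    rintro a b ⟨y, hy⟩ ⟨z, hz⟩
    exact ⟨y + z, fun U V h => by rw [map_add, map_add, hy U V h, hz U V h]⟩
  neg_mem' := by
    rintro a ⟨y, hy⟩
    exact ⟨-y, fun U V h => by rw [map_neg, map_neg, hy U V h]⟩

theorem ofSet_mem_of_cosets [Finite C] (S : AddSubgroup (BurnsideRing C)) :
    ∀ (n : ℕ) (X : FinGSet C), Nat.card X.carrier = n →
      (∀ x : X.carrier, ofSet (cosets (MulAction.stabilizer C x)) ∈ S) → ofSet X ∈ S := by
  intro n
  induction n using Nat.strong_induction_on with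
  | _ n ih =>
    intro X hn h
    rcases isEmpty_or_nonempty X.carrier with hX | ⟨⟨x⟩⟩
    · rw [ofSet_of_isEmpty]
      exact S.zero_mem
    · obtain ⟨Y, hY, f, hf, hf', -⟩ := exists_split X x
      rw [ofSet_eq_of_iso hY, ofSet_sum]
      refine S.add_mem (h x) (ih _ ?_ Y rfl fun y => ?_)
      · obtain ⟨e, -⟩ := hY
        have h1 := Nat.card_congr e
        have h2 : Nat.card (sum (cosets (MulAction.stabilizer C x)) Y).carrier =
          Nat.card (C ⧸ MulAction.stabilizer C x) + Nat.card Y.carrier := Nat.card_sum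
        have h3 : 0 < Nat.card (C ⧸ MulAction.stabilizer C x) := Nat.card_pos
        omega
      · have : MulAction.stabilizer C y = MulAction.stabilizer C (f y) := by
          ext g
          rw [MulAction.mem_stabilizer_iff, MulAction.mem_stabilizer_iff, ← hf', hf.eq_iff]
        rw [this]
        exact h (f y)

theorem cosets_mem_fwDomain [Finite G] [Finite C] [IsCyclic C] (hC : Nat.card C = Nat.card G) :
    ∀ (d : ℕ) (D : Subgroup C), Nat.card D = d → ofSet (cosets D) ∈ fwDomain G C := by
  intro d
  induction d using Nat.strong_induction_on with
  | _ d ih =>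
    intro D hD
    let P : FinGSet C := subsets C d
    have hmem : ∀ (g : C) (A : P.carrier) (x : C), x ∈ (g • A).1 ↔ x * g ∈ A.1 :=
      fun _ _ _ => Iff.rfl
    have hP : ofSet P ∈ fwDomain G C := by
      refine ⟨ofSet (subsets G d), fun U V h => ?_⟩
      rw [mark_ofSet, mark_ofSet, card_fixed_subsets_eq hC U V h]
    let D' : P.carrier := ⟨(D : Set C), hD⟩
    have hstab : MulAction.stabilizer C D' = D := by
      ext g
      rw [MulAction.mem_stabilizer_iff]
      constructor
      · intro h
        have h1 : (1 : C) ∈ (g⁻¹ • D').1 := by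
          rw [inv_smul_eq_iff.2 h.symm]
          exact D.one_mem
        rw [hmem, one_mul] at h1
        exact D.inv_mem_iff.1 h1
      · intro h
        refine Subtype.ext (Set.ext fun x => ?_)
        exact D.mul_mem_cancel_right h
    obtain ⟨Y, hY, f, hf, hf', hf''⟩ := exists_split P D'
    rw [hstab] at hY
    have hsum := hP
    rw [ofSet_eq_of_iso hY, ofSet_sum] at hsum
    refine ((fwDomain G C).add_mem_cancel_right ?_).1 hsum
    refine ofSet_mem_of_cosets _ _ Y rfl fun y => ?_
    refine ih _ ?_ _ rfl
    -- a `d`-element subset outside the orbit of `D` has a stabilizer of order less than `d`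
    set S := MulAction.stabilizer C y with hS
    have hmul : ∀ g ∈ S, ∀ x, x ∈ (f y).1 → x * g ∈ (f y).1 := by
      intro g hg x hx
      have h1 : g • f y = f y := by rw [← hf', MulAction.mem_stabilizer_iff.1 hg]
      rw [← hmem, h1]
      exact hx
    have hcard : Nat.card (f y).1 = d := (f y).2
    have hdpos : 0 < d := hD ▸ Nat.card_pos
    obtain ⟨a, ha⟩ : (f y).1.Nonempty := by
      rw [← hcard, Nat.card_pos_iff] at hdpos
      obtain ⟨⟨a, ha⟩⟩ := hdpos.1
      exact ⟨a, ha⟩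
    let F : S → (f y).1 := fun s => ⟨a * s, hmul s s.2 a ha⟩
    have hF : Function.Injective F := fun s t h =>
      Subtype.ext (mul_left_cancel (congrArg Subtype.val h))
    have hle : Nat.card S ≤ d := hcard ▸ Nat.card_le_card_of_injective F hF
    refine lt_of_le_of_ne hle fun heq => hf'' y ?_
    have hSD : S = D := eq_of_card_eq (heq.trans hD.symm)
    have hbij : Function.Bijective F :=
      hF.bijective_of_nat_card_le (by rw [hcard, heq])
    refine ⟨a⁻¹, Subtype.ext (Set.ext fun x => ?_)⟩
    change x * a⁻¹ ∈ D ↔ x ∈ (f y).1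
    have hcomm : ∀ b c : C, b * c = c * b := fun b c => IsCyclic.isMulCommutative.is_comm.comm b c
    rw [← hSD, hcomm]
    constructor
    · intro hx
      have := hmul _ hx a ha
      rwa [mul_inv_cancel_left] at this
    · intro hx
      obtain ⟨s, hs⟩ := hbij.2 ⟨x, hx⟩
      have hs' : a * s = x := congrArg Subtype.val hs
      rw [← hs', inv_mul_cancel_left]
      exact s.2

/-- Existence and uniqueness of the Frobenius-Wielandt morphism. -/
theorem existsUnique_isFW [Finite G] [Finite C] [IsCyclic C] (hC : Nat.card C = Nat.card G) :
    ∃! α : BurnsideRing C →+* BurnsideRing G, IsFW α := by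
  have hV : ∀ U : Subgroup G, ∃ V : Subgroup C, Nat.card V = Nat.card U := fun U =>
    exists_card_eq (hC ▸ U.card_subgroup_dvd_card)
  have hex : ∀ x : BurnsideRing C, x ∈ fwDomain G C := by
    intro x
    obtain ⟨p, rfl⟩ := exists_eq_sub x
    exact (fwDomain G C).sub_mem
      (ofSet_mem_of_cosets _ _ _ rfl fun _ => cosets_mem_fwDomain hC _ _ rfl)
      (ofSet_mem_of_cosets _ _ _ rfl fun _ => cosets_mem_fwDomain hC _ _ rfl)
  choose α hα using hex
  refine ⟨{ toFun := α, map_one' := ?_, map_mul' := ?_, map_zero' := ?_, map_add' := ?_ },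
    fun U V h x => hα x U V h, ?_⟩
  · refine ext_mark fun U => ?_
    obtain ⟨V, h⟩ := hV U
    rw [hα _ U V h, map_one, map_one]
  · refine fun x y => ext_mark fun U => ?_
    obtain ⟨V, h⟩ := hV U
    rw [hα _ U V h, map_mul, map_mul, hα _ U V h, hα _ U V h]
  · refine ext_mark fun U => ?_
    obtain ⟨V, h⟩ := hV U
    rw [hα _ U V h, map_zero, map_zero]
  · refine fun x y => ext_mark fun U => ?_
    obtain ⟨V, h⟩ := hV U
    rw [hα _ U V h, map_add, map_add, hα _ U V h, hα _ U V h]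
  · intro β hβ
    refine RingHom.ext fun x => ext_mark fun U => ?_
    obtain ⟨V, h⟩ := hV U
    exact (hβ U V h x).trans (hα x U V h).symm

/-- The Frobenius-Wielandt morphism `α^G : B(C) → B(G)`, for `C` a cyclic group of order `|G|`. -/
def fw [Finite G] [Finite C] [IsCyclic C] (hC : Nat.card C = Nat.card G) :
    BurnsideRing C →+* BurnsideRing G :=
  (existsUnique_isFW hC).choose

theorem isFW_fw [Finite G] [Finite C] [IsCyclic C] (hC : Nat.card C = Nat.card G) : IsFW (fw hC) :=
  (existsUnique_isFW hC).choose_spec.1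

end

/-! ### Tensor induction -/

section

variable {G : Type u} [Group G]

/-- The subgroup `K^g ∩ H` of `H`, where `K^g = g⁻¹ K g`. -/
def conjInter (K H : Subgroup G) (g : G) : Subgroup H :=
  (K.comap (MulAut.conj g).toMonoidHom).subgroupOf H

theorem mem_conjInter {K H : Subgroup G} {g : G} {h : H} :
    h ∈ conjInter K H g ↔ g * h * g⁻¹ ∈ K := Iff.rfl

/-- Tensor induction of an `H`-set `X`: the set of maps `f : G → X` such that
`f (g h) = h⁻¹ f g` for all `g ∈ G`, `h ∈ H`, with `G`-action `(g f) g₁ = f (g⁻¹ g₁)`. -/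
def FinGSet.tensor [Finite G] (H : Subgroup G) (X : FinGSet H) : FinGSet G :=
  letI : MulAction G {f : G → X.carrier // ∀ (g : G) (h : H), f (g * h) = h⁻¹ • f g} :=
    { smul := fun g f => ⟨fun g₁ => f.1 (g⁻¹ * g₁), fun g₁ h => by
        change f.1 (g⁻¹ * (g₁ * h)) = h⁻¹ • f.1 (g⁻¹ * g₁)
        rw [← mul_assoc, f.2]⟩
      one_smul := fun f => Subtype.ext (by
        funext g₁
        change f.1 (1⁻¹ * g₁) = f.1 g₁
        rw [inv_one, one_mul])
      mul_smul := fun a b f => Subtype.ext (by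
        funext g₁
        change f.1 ((a * b)⁻¹ * g₁) = f.1 (b⁻¹ * (a⁻¹ * g₁))
        rw [mul_inv_rev, mul_assoc]) }
  ⟨{f : G → X.carrier // ∀ (g : G) (h : H), f (g * h) = h⁻¹ • f g}⟩

instance [Finite G] (K H : Subgroup G) : Finite (DoubleCoset.Quotient (K : Set G) H) :=
  inferInstanceAs (Finite (_root_.Quotient (DoubleCoset.setoid (K : Set G) H)))

theorem card_fixed_tensor [Finite G] (K H : Subgroup G)
    [Fintype (DoubleCoset.Quotient (K : Set G) H)] (X : FinGSet H) :
    Nat.card (fixed K (tensor H X)) =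
      ∏ q : DoubleCoset.Quotient (K : Set G) H, Nat.card (fixed (conjInter K H q.out) X) := by
  rw [← Nat.card_pi]
  have hfix : ∀ (f : fixed K (tensor H X)) (k : G), k ∈ K → ∀ g, f.1.1 (k * g) = f.1.1 g := by
    intro f k hk g
    have h1 := congrArg (fun z => z.1 g) (f.2 k⁻¹ (K.inv_mem hk))
    have h2 : f.1.1 (k⁻¹⁻¹ * g) = f.1.1 g := h1
    rwa [inv_inv] at h2
  have hdec : ∀ g : G, ∃ k ∈ K, ∃ h : H, g = k * (DoubleCoset.mk K H g).out * h := by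
    intro g
    obtain ⟨k, hk, h, hh, e⟩ := (DoubleCoset.eq K H _ g).1 (DoubleCoset.out_eq' K H _)
    exact ⟨k, hk, ⟨h, hh⟩, e⟩
  let F : fixed K (tensor H X) → ∀ q : DoubleCoset.Quotient (K : Set G) H,
      fixed (conjInter K H q.out) X := fun f q => ⟨f.1.1 q.out, fun h hh => by
    rw [mem_conjInter] at hh
    have h1 := hfix f _ hh q.out
    rw [inv_mul_cancel_right, f.1.2] at h1
    exact (inv_smul_eq_iff.1 h1).symm⟩
  refine Nat.card_congr (Equiv.ofBijective F ⟨?_, ?_⟩)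
  · intro f f' h
    refine Subtype.ext (Subtype.ext (funext fun g => ?_))
    obtain ⟨k, hk, h', e⟩ := hdec g
    have h1 : f.1.1 (DoubleCoset.mk K H g).out = f'.1.1 (DoubleCoset.mk K H g).out :=
      congrArg Subtype.val (congrFun h (DoubleCoset.mk K H g))
    rw [e, f.1.2, f'.1.2, hfix f k hk, hfix f' k hk, h1]
  · intro x
    choose k hk h hdec using hdec
    have huniq : ∀ (g : G) (k' : G), k' ∈ K → ∀ (h' : H) (q : DoubleCoset.Quotient (K : Set G) H),
        g = k' * q.out * h' → (h g)⁻¹ • (x (DoubleCoset.mk K H g)).1 = h'⁻¹ • (x q).1 := by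
      intro g k' hk' h' q e
      have hq : q = DoubleCoset.mk K H g := by
        rw [← DoubleCoset.out_eq' K H q]
        exact (DoubleCoset.eq K H _ _).2 ⟨k', hk', h', h'.2, e⟩
      subst hq
      set r := (DoubleCoset.mk K H g).out with hr
      have hmem : h' * (h g)⁻¹ ∈ conjInter K H r := by
        rw [mem_conjInter]
        have e' : k' * r * h' = k g * r * h g := e.symm.trans (hdec g)
        have : r * ((h' * (h g)⁻¹ : H) : G) * r⁻¹ = k'⁻¹ * k g := by
          have h3 : r * (h' : G) = k'⁻¹ * (k g * r * h g) := by
            rw [← e', mul_assoc, inv_mul_cancel_left]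
          push_cast
          rw [← mul_assoc, h3]
          group
        rw [this]
        exact K.mul_mem (K.inv_mem hk') (hk g)
      have h2 := (x (DoubleCoset.mk K H g)).2 _ hmem
      rw [eq_inv_smul_iff, ← mul_smul]
      exact h2
    let f : (tensor H X).carrier := ⟨fun g => (h g)⁻¹ • (x (DoubleCoset.mk K H g)).1, fun g a => by
      have e : g * a = k g * (DoubleCoset.mk K H g).out * ((h g * a : H) : G) := by
        rw [Subgroup.coe_mul, ← mul_assoc, ← hdec g]
      refine (huniq (g * a) (k g) (hk g) (h g * a) _ e).trans ?_
      rw [mul_inv_rev, mul_smul]⟩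
    refine ⟨⟨f, fun a ha => Subtype.ext (funext fun g => ?_)⟩, ?_⟩
    · refine huniq (a⁻¹ * g) (a⁻¹ * k g) (K.mul_mem (K.inv_mem ha) (hk g)) (h g) _ ?_
      rw [mul_assoc, mul_assoc, ← mul_assoc (k g), ← hdec g]
    · funext q
      refine Subtype.ext ?_
      have := huniq q.out 1 K.one_mem 1 q (by simp)
      rw [inv_one, one_smul] at this
      exact this

/-- The disjoint union of `X` and `n` copies of `Y`. -/
def FinGSet.addCopies (X Y : FinGSet G) : ℕ → FinGSet G
  | 0 => X
  | n + 1 => sum (addCopies X Y n) Y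

theorem ofSet_addCopies (X Y : FinGSet G) (n : ℕ) :
    ofSet (addCopies X Y n) = ofSet X + n * ofSet Y := by
  induction n with
  | zero => simp [addCopies]
  | succ n ih =>
    rw [addCopies, ofSet_sum, ih]
    push_cast
    ring

/-- The value at `-1` of an integer polynomial of degree at most `n` in terms of its values at
`0, …, n`. -/
theorem extrapolate (p : Polynomial ℤ) (n : ℕ) (hp : p.natDegree ≤ n) :
    ∑ i ∈ Finset.range (n + 1), (-1 : ℤ) ^ i * (n + 1).choose (i + 1) * p.eval (i : ℤ) =
      p.eval (-1) := by
  have h := congrFun (Polynomial.fwdDiff_iter_eq_zero_of_degree_lt (Nat.lt_succ_of_le hp)) (-1)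
  rw [fwdDiff_iter_eq_sum_shift, Finset.sum_range_succ'] at h
  have h2 := congrArg (fun z => (-1 : ℤ) ^ n * z) h
  simp only [Pi.zero_apply, mul_zero, mul_add, Finset.mul_sum, smul_eq_mul] at h2
  have e : ∀ i ∈ Finset.range (n + 1), (-1 : ℤ) ^ n * ((-1) ^ (n + 1 - (i + 1)) *
      ((n + 1).choose (i + 1)) * p.eval (-1 + (i + 1) • 1)) =
      (-1 : ℤ) ^ i * (n + 1).choose (i + 1) * p.eval (i : ℤ) := by
    intro i hi
    have hi' : i ≤ n := Nat.lt_succ_iff.1 (Finset.mem_range.1 hi)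
    obtain ⟨j, rfl⟩ := Nat.exists_eq_add_of_le hi'
    have h1 : i + j + 1 - (i + 1) = j := by omega
    have h3 : (-1 : ℤ) + (i + 1) • 1 = i := by simp
    have h4 : (-1 : ℤ) ^ (i + j) * (-1) ^ j = (-1) ^ i := by
      rw [pow_add, mul_assoc, ← mul_pow]
      simp
    rw [h1, h3, ← mul_assoc, ← mul_assoc, h4]
  rw [Nat.succ_eq_add_one, Finset.sum_congr rfl e] at h2
  have h5 : (-1 : ℤ) ^ n * ((-1) ^ (n + 1 - 0) * ((n + 1).choose 0 : ℕ) *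
      p.eval (-1 + 0 • 1)) = -p.eval (-1) := by
    have : (-1 : ℤ) ^ n * (-1) ^ n = 1 := by rw [← mul_pow]; simp
    simp only [Nat.sub_zero, Nat.choose_zero_right, zero_smul, add_zero, Nat.cast_one, mul_one,
      pow_succ]
    linear_combination (-p.eval (-1)) * this
  rw [h5] at h2
  linarith

/-- The value of tensor induction at `[X] - [Y]`. The class of the tensor induction of the disjoint
union of `X` and `k` copies of `Y` is polynomial of degree at most `n = [G : H]` in `k`; this is the
value at `k = -1` of that polynomial, computed from the values at `k = 0, …, n`. -/
def tenSub [Finite G] (H : Subgroup G) (X Y : FinGSet H) : BurnsideRing G :=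
  ∑ k ∈ Finset.range (H.index + 1),
    ((-1 : ℤ) ^ k * ((H.index + 1).choose (k + 1) : ℤ) : ℤ) • ofSet (tensor H (addCopies X Y k))

theorem card_doubleCoset_le [Finite G] (K H : Subgroup G)
    [Fintype (DoubleCoset.Quotient (K : Set G) H)] :
    Fintype.card (DoubleCoset.Quotient (K : Set G) H) ≤ H.index := by
  rw [← Nat.card_eq_fintype_card, Subgroup.index]
  let f : G ⧸ H → DoubleCoset.Quotient (K : Set G) H := fun q => DoubleCoset.mk K H q.out
  refine Nat.card_le_card_of_surjective f fun q => ⟨(q.out : G), ?_⟩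
  obtain ⟨h, hh⟩ := QuotientGroup.mk_out_eq_mul H q.out
  change DoubleCoset.mk K H _ = q
  rw [hh, ← DoubleCoset.out_eq' K H q, DoubleCoset.eq]
  refine ⟨1, K.one_mem, h⁻¹, H.inv_mem h.2, ?_⟩
  rw [DoubleCoset.out_eq' K H q]
  group

theorem mark_tenSub [Finite G] (K H : Subgroup G)
    [Fintype (DoubleCoset.Quotient (K : Set G) H)] (X Y : FinGSet H) :
    mark K (tenSub H X Y) = ∏ q : DoubleCoset.Quotient (K : Set G) H,
      mark (conjInter K H q.out) (ofSet X - ofSet Y) := by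
  let p : Polynomial ℤ := ∏ q : DoubleCoset.Quotient (K : Set G) H,
    (Polynomial.C (mark (conjInter K H q.out) (ofSet X)) +
      Polynomial.C (mark (conjInter K H q.out) (ofSet Y)) * Polynomial.X)
  have hp : p.natDegree ≤ H.index := by
    refine (Polynomial.natDegree_prod_le _ _).trans (le_trans ?_ (card_doubleCoset_le K H))
    refine (Finset.sum_le_card_nsmul _ _ 1 fun q _ => ?_).trans (by simp)
    rw [add_comm]
    exact Polynomial.natDegree_linear_le
  have heval : ∀ z : ℤ, p.eval z = ∏ q : DoubleCoset.Quotient (K : Set G) H,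
      (mark (conjInter K H q.out) (ofSet X) + mark (conjInter K H q.out) (ofSet Y) * z) := by
    intro z
    rw [Polynomial.eval_prod]
    simp
  have hk : ∀ k : ℕ, mark K (ofSet (tensor H (addCopies X Y k))) = p.eval (k : ℤ) := by
    intro k
    rw [mark_ofSet, card_fixed_tensor, heval]
    push_cast
    refine Finset.prod_congr rfl fun q _ => ?_
    rw [← mark_ofSet, ofSet_addCopies, map_add, map_mul, map_natCast, mul_comm]
  rw [tenSub, map_sum]
  simp only [map_zsmul, hk, smul_eq_mul]
  rw [extrapolate p _ hp, heval]
  refine Finset.prod_congr rfl fun q _ => ?_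
  rw [map_sub]
  ring

/-- The underlying map of tensor induction; it does not depend on the chosen representation of `a`
as a difference of classes of finite `H`-sets. -/
def tenFun [Finite G] (H : Subgroup G) (a : BurnsideRing H) : BurnsideRing G :=
  tenSub H (exists_eq_sub a).choose.1 (exists_eq_sub a).choose.2

theorem mark_tenFun [Finite G] (K H : Subgroup G)
    [Fintype (DoubleCoset.Quotient (K : Set G) H)] (a : BurnsideRing H) :
    mark K (tenFun H a) = ∏ q : DoubleCoset.Quotient (K : Set G) H,
      mark (conjInter K H q.out) a := by
  rw [tenFun, mark_tenSub, ← (exists_eq_sub a).choose_spec]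

/-- Tensor induction `Ten_H^G : B(H) → B(G)`, a multiplicative map. -/
def ten [Finite G] (H : Subgroup G) : BurnsideRing H →* BurnsideRing G where
  toFun := tenFun H
  map_one' := ext_mark fun K => by
    have := Fintype.ofFinite (DoubleCoset.Quotient (K : Set G) H)
    simp [mark_tenFun]
  map_mul' a b := ext_mark fun K => by
    have := Fintype.ofFinite (DoubleCoset.Quotient (K : Set G) H)
    simp [mark_tenFun, Finset.prod_mul_distrib]

theorem mark_ten [Finite G] (K H : Subgroup G)
    [Fintype (DoubleCoset.Quotient (K : Set G) H)] (a : BurnsideRing H) :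
    mark K (ten H a) = ∏ q : DoubleCoset.Quotient (K : Set G) H,
      mark (conjInter K H q.out) a :=
  mark_tenFun K H a

/-- On differences of classes of sets, independently of the representation. -/
theorem ten_sub [Finite G] (H : Subgroup G) (X Y : FinGSet H) :
    ten H (ofSet X - ofSet Y) = tenSub H X Y :=
  ext_mark fun K => by
    have := Fintype.ofFinite (DoubleCoset.Quotient (K : Set G) H)
    rw [mark_ten, mark_tenSub]

/-- On actual `H`-sets `ten` is the class of the set of `H`-equivariant maps `G → X`. -/
theorem ten_ofSet [Finite G] (H : Subgroup G) (X : FinGSet H) :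
    ten H (ofSet X) = ofSet (tensor H X) :=
  ext_mark fun K => by
    have := Fintype.ofFinite (DoubleCoset.Quotient (K : Set G) H)
    rw [mark_ten, mark_ofSet, card_fixed_tensor]
    push_cast
    exact Finset.prod_congr rfl fun q _ => mark_ofSet _ _

/-- The gcd property of `G` and `H`: `|K ∩ H| = gcd(|K|, |H|)` for all `K ≤ G`. -/
def GcdProperty (H : Subgroup G) : Prop :=
  ∀ K : Subgroup G, Nat.card (K ⊓ H : Subgroup G) = Nat.gcd (Nat.card K) (Nat.card H)

end

end

end FrobWiel

namespace FrobWiel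

/-! Elements of a Burnside ring are determined by their marks, so both composites are compared mark
by mark. Fix `K ≤ G` and the subgroup `V` of `C` of order `|K|`. By `mark_ten`, the mark at `K` of
`Ten_H^G (α^H x)` is a product over `K\G/H` of marks of `x` at subgroups of order `|K^g ∩ H|`. The
mark at `K` of `α^G (Ten x)` is the analogous product over the double cosets of `V` and `C_H` in
`C`.

A double coset `KgH` has `|K||H| / |K^g ∩ H|` elements, and `|K^g ∩ H|` divides `gcd(|K|,|H|)`.
Hence there are at most `gcd(|K|,|H|)|G| / (|K||H|)` double cosets, with equality exactly when every
`|K^g ∩ H|` is the gcd. So the gcd property says that the number of double cosets is maximal for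
each `K` (`gcdProperty_iff_card_doubleCosets`). A cyclic group always attains this bound
(`gcdProperty_of_isCyclic`).

If the maps agree, evaluating them at `x = 2` gives powers of 2 whose exponents are the numbers of
double cosets. The number in `G` then equals the maximal number attained in `C`. Conversely, under
the gcd property both products have the same number of factors, all equal to one mark of `x`.
Normality follows by taking `K = H`. -/

/-! ### Sizes of double cosets and of the subgroups `K^g ∩ H` -/

open DoubleCoset in
-- Orbit-stabilizer for `K × H` acting on `G` from both sides: the orbit of `r` is `KrH`, and its
-- stabilizer is a copy of `K^r ∩ H`.
theorem card_doubleCoset_mul_card_conjInter {G : Type u} [Group G] (K H : Subgroup G) (r : G) :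
    Nat.card {x : G // mk K H x = mk K H r} * Nat.card (conjInter K H r) =
      Nat.card K * Nat.card H := by
  have hdec : ∀ x : {x : G // mk K H x = mk K H r}, ∃ (k : K) (h : H), x.1 = k * r * h := by
    intro x
    obtain ⟨k, hk, h, hh, e⟩ := (DoubleCoset.eq K H r x.1).1 x.2.symm
    exact ⟨⟨k, hk⟩, ⟨h, hh⟩, e⟩
  choose k h hkh using hdec
  rw [← Nat.card_prod, ← Nat.card_prod]
  -- An element `c` of `K^r ∩ H` changes the chosen factorization `x = k r h` into `(k · r c r⁻¹) r
  -- (c⁻¹ h)`, and every factorization of `x` arises this way exactly once.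
  refine Nat.card_congr (Equiv.ofBijective
    (fun p => (k p.1 * ⟨r * p.2.1 * r⁻¹, p.2.2⟩, (p.2.1)⁻¹ * h p.1)) ⟨?_, ?_⟩)
  · rintro ⟨x, c⟩ ⟨y, d⟩ hxy
    have h1 := congrArg (fun p : K × H => (p.1 : G) * r * p.2) hxy
    have h2 : ∀ (x : {x : G // mk K H x = mk K H r}) (c : H),
        (k x : G) * (r * c * r⁻¹) * r * ((c : G)⁻¹ * h x) = x := by
      intro x c
      rw [hkh x]
      group
    simp only [Subgroup.coe_mul, Subgroup.coe_inv, h2] at h1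
    obtain rfl := Subtype.ext h1
    have h3 := congrArg Prod.snd hxy
    simp only [mul_left_inj, inv_inj] at h3
    rw [Subtype.ext h3]
  · rintro ⟨a, b⟩
    let x : {x : G // mk K H x = mk K H r} :=
      ⟨a * r * b, ((DoubleCoset.eq K H r _).2 ⟨a, a.2, b, b.2, rfl⟩).symm⟩
    have hx : (a : G) * r * b = k x * r * h x := hkh x
    have h1 : r * ((h x * b⁻¹ : H) : G) * r⁻¹ = ((k x)⁻¹ * a : K) := by
      have : r * (h x : G) = (k x : G)⁻¹ * (a * r * b) := by
        rw [hx]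
        group
      push_cast
      rw [← mul_assoc, this]
      group
    refine ⟨⟨x, ⟨h x * b⁻¹, mem_conjInter.2 (h1 ▸ Subtype.property _)⟩⟩, Prod.ext ?_ ?_⟩
    · refine Subtype.ext ?_
      change (k x : G) * (r * ((h x * b⁻¹ : H) : G) * r⁻¹) = a
      rw [h1, ← Subgroup.coe_mul, mul_inv_cancel_left]
    · simp

theorem card_fiber_mul_card_conjInter_out {G : Type u} [Group G] (K H : Subgroup G)
    (q : DoubleCoset.Quotient (K : Set G) H) :
    Nat.card {x : G // DoubleCoset.mk K H x = q} * Nat.card (conjInter K H q.out) =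
      Nat.card K * Nat.card H := by
  have h := card_doubleCoset_mul_card_conjInter K H q.out
  rwa [DoubleCoset.out_eq'] at h

/-- Conjugation by `g` embeds this subgroup of `H` into `K`, so Lagrange applies in both groups.
This is the source of the upper bound on the number of double cosets. -/
theorem card_conjInter_dvd_gcd {G : Type u} [Group G] (K H : Subgroup G) (g : G) :
    Nat.card (conjInter K H g) ∣ Nat.gcd (Nat.card K) (Nat.card H) := by
  refine Nat.dvd_gcd ?_ (conjInter K H g).card_subgroup_dvd_card
  let f : conjInter K H g →* K :=
    { toFun := fun c => ⟨g * c.1 * g⁻¹, c.2⟩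
      map_one' := by ext; simp
      map_mul' := fun a b => by ext; simp }
  refine Subgroup.card_dvd_of_injective f fun a b hab => ?_
  have := congrArg Subtype.val hab
  simp only [f, MonoidHom.coe_mk, OneHom.coe_mk, mul_left_inj, mul_right_inj] at this
  exact Subtype.ext (Subtype.ext this)

theorem card_conjInter_one {G : Type u} [Group G] (K H : Subgroup G) :
    Nat.card (conjInter K H 1) = Nat.card (K ⊓ H : Subgroup G) := by
  refine Nat.card_congr
    { toFun := fun c => ⟨c.1, by simpa using mem_conjInter.1 c.2, c.1.2⟩
      invFun := fun c => ⟨⟨c.1, c.2.2⟩, mem_conjInter.2 (by simpa using c.2.1)⟩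
      left_inv := fun _ => rfl
      right_inv := fun _ => rfl }

/-! ### Consequences of the gcd property, and the cyclic case -/

/-- The property quantifies over all subgroups, so it applies to `g⁻¹Kg`, which has the order of
`K`. -/
theorem GcdProperty.card_conjInter {G : Type u} [Group G] {H : Subgroup G} (hH : GcdProperty H)
    (K : Subgroup G) (g : G) :
    Nat.card (conjInter K H g) = Nat.gcd (Nat.card K) (Nat.card H) := by
  let K' : Subgroup G := K.comap (MulAut.conj g).toMonoidHom
  have h1 : Nat.card K' = Nat.card K :=
    Nat.card_congr ((MulAut.conj g).toEquiv.subtypeEquiv fun _ => Iff.rfl)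
  have h2 : conjInter K H g = conjInter K' H 1 := by
    ext c
    change _ ↔ (MulAut.conj g) (1 * (c : G) * 1⁻¹) ∈ K
    simp [mem_conjInter]
  rw [h2, card_conjInter_one, hH K', h1]

/-- With `K = H` the gcd is `|H|`, so each `H^g ∩ H` is all of `H`. -/
theorem GcdProperty.normal {G : Type u} [Group G] [Finite G] {H : Subgroup G}
    (hH : GcdProperty H) : H.Normal := by
  refine ⟨fun n hn g => ?_⟩
  have h1 : Nat.card (conjInter H H g) = Nat.card H := by rw [hH.card_conjInter, Nat.gcd_self]
  have h2 := (conjInter H H g).card_eq_iff_eq_top.1 h1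
  exact mem_conjInter.1 (h2 ▸ Subgroup.mem_top (⟨n, hn⟩ : H))

theorem gcdProperty_of_isCyclic {C : Type v} [Group C] [Finite C] [IsCyclic C] (W : Subgroup C) :
    GcdProperty W := by
  intro V
  -- `U` is itself cyclic, so it contains a subgroup of order `d`, which must be `E` by uniqueness
  -- in `C`. Thus the subgroup of order the gcd lies in both `V` and `W`.
  have key : ∀ (d : ℕ) (E U : Subgroup C), Nat.card E = d → d ∣ Nat.card U → E ≤ U := by
    intro d E U hE hd
    obtain ⟨F, hF⟩ := exists_card_eq hd
    have h1 : Nat.card (F.map U.subtype) = d := by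
      rw [Subgroup.card_subtype, hF]
    rw [eq_of_card_eq (hE.trans h1.symm)]
    exact Subgroup.map_subtype_le F
  refine Nat.dvd_antisymm (Nat.dvd_gcd (Subgroup.card_dvd_of_le inf_le_left)
    (Subgroup.card_dvd_of_le inf_le_right)) ?_
  obtain ⟨E, hE⟩ := exists_card_eq ((Nat.gcd_dvd_left (Nat.card V) (Nat.card W)).trans
    V.card_subgroup_dvd_card)
  rw [← hE]
  exact Subgroup.card_dvd_of_le (le_inf (key _ E V hE (Nat.gcd_dvd_left _ _))
    (key _ E W hE (Nat.gcd_dvd_right _ _)))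

/-! ### The number of double cosets -/

section

variable {G : Type u} [Group G] [Finite G] (K H : Subgroup G)
  [Fintype (DoubleCoset.Quotient (K : Set G) H)]

theorem sum_card_doubleCoset :
    ∑ q : DoubleCoset.Quotient (K : Set G) H, Nat.card {x : G // DoubleCoset.mk K H x = q} =
      Nat.card G := by
  rw [← Nat.card_sigma]
  exact Nat.card_congr (Equiv.sigmaFiberEquiv _)

/-- The left side is the sum of `|KgH| · |K^g ∩ H|` over the double cosets, the right side the sum
of `|KgH| · gcd`. The first is termwise at most the second, so equal sums force equal terms, and the
nonzero factor `|KgH|` cancels. -/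
theorem card_doubleCosets_mul_eq_iff :
    Fintype.card (DoubleCoset.Quotient (K : Set G) H) * (Nat.card K * Nat.card H) =
        Nat.gcd (Nat.card K) (Nat.card H) * Nat.card G ↔
      ∀ q : DoubleCoset.Quotient (K : Set G) H,
        Nat.card (conjInter K H q.out) = Nat.gcd (Nat.card K) (Nat.card H) := by
  have hpos : ∀ q : DoubleCoset.Quotient (K : Set G) H,
      Nat.card {x : G // DoubleCoset.mk K H x = q} ≠ 0 := by
    intro q h
    have := card_fiber_mul_card_conjInter_out K H q
    rw [h, zero_mul] at this
    exact (Nat.mul_pos Nat.card_pos Nat.card_pos).ne this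
  have h1 : Fintype.card (DoubleCoset.Quotient (K : Set G) H) * (Nat.card K * Nat.card H) =
      ∑ q : DoubleCoset.Quotient (K : Set G) H,
        Nat.card {x : G // DoubleCoset.mk K H x = q} * Nat.card (conjInter K H q.out) := by
    simp [card_fiber_mul_card_conjInter_out]
  have h2 : Nat.gcd (Nat.card K) (Nat.card H) * Nat.card G =
      ∑ q : DoubleCoset.Quotient (K : Set G) H,
        Nat.card {x : G // DoubleCoset.mk K H x = q} * Nat.gcd (Nat.card K) (Nat.card H) := by
    rw [← Finset.sum_mul, sum_card_doubleCoset, mul_comm]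
  rw [h1, h2, Finset.sum_eq_sum_iff_of_le fun q _ => Nat.mul_le_mul_left _
    (Nat.le_of_dvd (Nat.gcd_pos_of_pos_left _ Nat.card_pos) (card_conjInter_dvd_gcd K H q.out))]
  exact forall_congr' fun q => by
    simp [hpos q]

end

/-- This trades intersections for the one quantity that marks of a constant detect. -/
theorem gcdProperty_iff_card_doubleCosets {G : Type u} [Group G] [Finite G] (H : Subgroup G) :
    GcdProperty H ↔ ∀ K : Subgroup G,
      Nat.card (DoubleCoset.Quotient (K : Set G) H) * (Nat.card K * Nat.card H) =
        Nat.gcd (Nat.card K) (Nat.card H) * Nat.card G := by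
  constructor
  · intro hH K
    have := Fintype.ofFinite (DoubleCoset.Quotient (K : Set G) H)
    rw [Nat.card_eq_fintype_card, card_doubleCosets_mul_eq_iff]
    exact fun q => hH.card_conjInter K q.out
  · intro h K
    have := Fintype.ofFinite (DoubleCoset.Quotient (K : Set G) H)
    have h1 := h K
    rw [Nat.card_eq_fintype_card, card_doubleCosets_mul_eq_iff] at h1
    let q := DoubleCoset.mk K H 1
    -- The representative `q.out` of the double coset of `1` need not be `1`. Both intersections
    -- nevertheless have the same order, since each order times the size of that double coset is
    -- `|K||H|`.
    have h2 := card_fiber_mul_card_conjInter_out K H q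
    have h3 := card_doubleCoset_mul_card_conjInter K H 1
    have hpos : 0 < Nat.card {x : G // DoubleCoset.mk K H x = q} :=
      Nat.card_pos_iff.2 ⟨⟨⟨1, rfl⟩⟩, inferInstance⟩
    rw [← card_conjInter_one, ← h1 q]
    exact Nat.eq_of_mul_eq_mul_left hpos (h3.trans h2.symm)

/-! ### Comparing marks of the two composites -/

/-- Ring homomorphisms fix the constant 2, so every factor of either mark is 2 and only the number
of factors remains. -/
theorem card_doubleCosets_of_fw_ten_two {G : Type u} [Group G] [Finite G] {C : Type v} [Group C]
    [Finite C] [IsCyclic C] (hC : Nat.card C = Nat.card G) {H : Subgroup G} {D : Subgroup C}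
    (hD : Nat.card D = Nat.card H) (h : fw hC (ten D 2) = ten H (fw hD 2))
    {K : Subgroup G} {V : Subgroup C} (hV : Nat.card V = Nat.card K) :
    Nat.card (DoubleCoset.Quotient (K : Set G) H) =
      Nat.card (DoubleCoset.Quotient (V : Set C) D) := by
  have := Fintype.ofFinite (DoubleCoset.Quotient (K : Set G) H)
  have := Fintype.ofFinite (DoubleCoset.Quotient (V : Set C) D)
  have h1 := congrArg (mark K) h
  rw [isFW_fw hC K V hV, mark_ten, mark_ten] at h1
  simp only [map_ofNat, Finset.prod_const, Finset.card_univ] at h1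
  rw [Nat.card_eq_fintype_card, Nat.card_eq_fintype_card]
  exact Nat.pow_right_injective le_rfl (by exact_mod_cast h1.symm)

theorem GcdProperty.fw_ten {G : Type u} [Group G] [Finite G] {C : Type v} [Group C]
    [Finite C] [IsCyclic C] (hC : Nat.card C = Nat.card G) {H : Subgroup G} {D : Subgroup C}
    (hD : Nat.card D = Nat.card H) (hH : GcdProperty H) (x : BurnsideRing D) :
    fw hC (ten D x) = ten H (fw hD x) := by
  refine ext_mark fun K => ?_
  obtain ⟨V, hV⟩ := exists_card_eq (C := C) (hC ▸ K.card_subgroup_dvd_card)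
  have := Fintype.ofFinite (DoubleCoset.Quotient (K : Set G) H)
  have := Fintype.ofFinite (DoubleCoset.Quotient (V : Set C) D)
  -- `W` is the only subgroup of `D` of this order, so all factors on both sides become the mark of
  -- `x` at `W`.
  obtain ⟨W, hW⟩ := exists_card_eq (C := D)
    (Nat.gcd_dvd_right (Nat.card K) (Nat.card D))
  -- Both counts attain the maximum, which depends only on the orders of the groups involved.
  have hN : Nat.card (DoubleCoset.Quotient (K : Set G) H) =
      Nat.card (DoubleCoset.Quotient (V : Set C) D) := by
    have h1 := (gcdProperty_iff_card_doubleCosets H).1 hH K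
    have h2 := (gcdProperty_iff_card_doubleCosets D).1 (gcdProperty_of_isCyclic D) V
    rw [hV, hD, hC, ← h1] at h2
    exact (Nat.eq_of_mul_eq_mul_right (Nat.mul_pos Nat.card_pos Nat.card_pos) h2).symm
  rw [isFW_fw hC K V hV, mark_ten, mark_ten]
  have hl : ∀ q : DoubleCoset.Quotient (V : Set C) D,
      mark (conjInter V D q.out) x = mark W x := fun q => by
    rw [eq_of_card_eq (D := conjInter V D q.out) (E := W)
      (by rw [(gcdProperty_of_isCyclic D).card_conjInter, hW, hV])]
  have hr : ∀ q : DoubleCoset.Quotient (K : Set G) H,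
      mark (conjInter K H q.out) (fw hD x) = mark W x := fun q =>
    isFW_fw hD _ W (by rw [hW, hH.card_conjInter, hD]) x
  simp only [hl, hr, Finset.prod_const, Finset.card_univ]
  rw [← Nat.card_eq_fintype_card, ← Nat.card_eq_fintype_card, hN]

end FrobWiel

theorem mainTheorem2 {G : Type u} [Group G] [Finite G] {C : Type v} [Group C] [Finite C]
    [IsCyclic C] (hC : Nat.card C = Nat.card G) (H : Subgroup G) (CH : Subgroup C)
    (hCH : Nat.card CH = Nat.card H) :
    ((∀ x : FrobWiel.BurnsideRing CH,
        FrobWiel.fw hC (FrobWiel.ten CH x) = FrobWiel.ten H (FrobWiel.fw hCH x)) ↔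
      FrobWiel.GcdProperty H) ∧
    ((∀ x : FrobWiel.BurnsideRing CH,
        FrobWiel.fw hC (FrobWiel.ten CH x) = FrobWiel.ten H (FrobWiel.fw hCH x)) →
      H.Normal) := by
  have key : (∀ x : FrobWiel.BurnsideRing CH,
      FrobWiel.fw hC (FrobWiel.ten CH x) = FrobWiel.ten H (FrobWiel.fw hCH x)) →
      FrobWiel.GcdProperty H := by
    intro h
    rw [FrobWiel.gcdProperty_iff_card_doubleCosets]
    intro K
    obtain ⟨V, hV⟩ := FrobWiel.exists_card_eq (C := C) (hC ▸ K.card_subgroup_dvd_card)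
    -- The maximal count holds in the cyclic group and is carried over to `G` by the hypothesis at
    -- `x = 2` alone.
    have h1 := (FrobWiel.gcdProperty_iff_card_doubleCosets CH).1
      (FrobWiel.gcdProperty_of_isCyclic CH) V
    rwa [hV, hCH, hC, ← FrobWiel.card_doubleCosets_of_fw_ten_two hC hCH (h 2) hV] at h1
  exact ⟨⟨key, fun hH x => hH.fw_ten hC hCH x⟩, fun h => (key h).normal⟩
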